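/- A $3$-polytope is the convex hull $P\subset\mathbb{R}^3$ of finitely many points, with nonempty interior. Two $3$-polytopes are combinatorially equivalent if their face lattices are isomorphic. A Koebe realization of $P$ is a $3$-polytope $K\subset\mathbb{R}^3$, combinatorially equivalent to $P$, each of whose edges is tangent to the unit sphere $\mathbb{S}^2$ at a point of that edge. Let $\mathbb{Q}[K]\subseteq\mathbb{R}$ denote the field generated over $\mathbb{Q}$ by the coordinates of the vertices of $K$. The Koebe degree of $P$ is $$\kappa(P)=\min\{[\mathbb{Q}[K]:\mathbb{Q}] : K \text{ a Koebe realization of } P\}\in\mathbb{N}\cup\{\infty\}.$$ A $3$-polytope $Q$ is dual to $P$ if it is combinatorially equivalent to the polar $R^\vee=\{a\in\mathbb{R}^3 : a\cdot v\le 1 \text{ for all } v\in R\}$ of a $3$-polytope $R$ that is combinatorially equivalent to $P$ and has the origin in its interior. **Proposition.** If $P$ and $Q$ are $3$-polytopes and $Q$ is dual to $P$, then $\kappa(P)=\kappa(Q)$. -/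

import Mathlib

namespace Koebe

/-- Euclidean 3-space. -/
abbrev E3 : Type := EuclideanSpace ℝ (Fin 3)

/-- A (full-dimensional) convex 3-polytope in `ℝ³`: the convex hull of finitely many points, with
nonempty interior. -/
def IsPolytope3 (P : Set E3) : Prop :=
  (∃ V : Set E3, V.Finite ∧ P = convexHull ℝ V) ∧ (interior P).Nonempty

/-- The faces of `P`: the empty face, `P` itself, and the sets of maximizers on `P` of linear
functionals. They are ordered by inclusion, as a subtype of `Set E3`. -/
abbrev Face (P : Set E3) : Type := {F : Set E3 // IsExposed ℝ P F}

/-- Combinatorial equivalence: the face lattices are isomorphic. -/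
def CombEquiv (P Q : Set E3) : Prop := Nonempty (Face P ≃o Face Q)

/-- An edge of `P` is a one-dimensional face. -/
def IsEdge (P F : Set E3) : Prop :=
  IsExposed ℝ P F ∧ Module.finrank ℝ (vectorSpan ℝ F) = 1

/-- `F` touches the unit sphere tangentially at one of its own points `x` (the contact point):
`x` lies on the sphere, and `F` lies in the tangent plane `{y | ⟪x, y⟫ = 1}` at `x`. -/
def IsTangentToSphere (F : Set E3) : Prop :=
  ∃ x ∈ F, ‖x‖ = 1 ∧ ∀ y ∈ F, inner ℝ x y = 1

/-- `K` is a Koebe realization of `P`. -/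
structure IsKoebeRealization (P K : Set E3) : Prop where
  isPolytope : IsPolytope3 K
  combEquiv : CombEquiv K P
  tangent : ∀ F : Set E3, IsEdge K F → IsTangentToSphere F

/-- The subfield of `ℝ` generated over `ℚ` by the coordinates of the vertices of `R`. -/
noncomputable def coordField (R : Set E3) : IntermediateField ℚ ℝ :=
  IntermediateField.adjoin ℚ {c : ℝ | ∃ v ∈ R.extremePoints ℝ, ∃ i : Fin 3, c = v i}

/-- The degree over `ℚ` of the field of vertex coordinates (`⊤` if it is infinite). -/
noncomputable def coordDegree (R : Set E3) : ℕ∞ :=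
  Cardinal.toENat (Module.rank ℚ (coordField R))

/-- The Koebe degree: the least degree of the field of vertex coordinates of a Koebe
realization of `P`. -/
noncomputable def koebeDegree (P : Set E3) : ℕ∞ :=
  sInf {d : ℕ∞ | ∃ K : Set E3, IsKoebeRealization P K ∧ d = coordDegree K}

/-- The polar of `P`. -/
def polar (P : Set E3) : Set E3 := {a : E3 | ∀ v ∈ P, inner ℝ a v ≤ 1}

/-- `Q` is dual to `P`: it is combinatorially equivalent to the polar of a realization of `P`
that has the origin in its interior. -/
def IsDual (P Q : Set E3) : Prop :=
  ∃ R : Set E3, IsPolytope3 R ∧ CombEquiv R P ∧ (0 : E3) ∈ interior R ∧ CombEquiv Q (polar R)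

end Koebe

namespace Koebe

open Set Filter Topology

/-! ### Convex hulls of finite sets -/

/-! Duality is symmetric (`IsDual.symm`), so it suffices to turn a Koebe realization `K` of `P` into
one of `Q` without enlarging the coordinate field (`exists_dual_koebeRealization`). Polarity in the
unit sphere would preserve edge tangency and the field, but the origin need not be interior to `K`.
The remedy is to move an interior point `p` of `K` to the origin by a projective automorphism of the
ball with rational coefficients before polarizing. A suitable `p` in the open ball exists because
`K` contains a chord of the sphere joining two contact points (`exists_mem_interior_norm_lt_one`);
density then allows `p = center a` with `a` rational. In practice only affine maps are needed: the
polar of `K - p` is taken, then `normalize` is applied. By `inner_normalize`, the dual of an edge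
touching the sphere is again tangent; this uses that the contact planes support `K`
(`inner_le_one_of_contact`). Vertices of the polar solve linear systems over the coordinate field
(`coord_mem_of_mem_extremePoints_polar`), and `normalize` is rational. -/

lemma convexHull_extremePoints_eq {V : Set E3} (hV : V.Finite) :
    convexHull ℝ ((convexHull ℝ V).extremePoints ℝ) = convexHull ℝ V := by
  have hfin : ((convexHull ℝ V).extremePoints ℝ).Finite := hV.subset extremePoints_convexHull_subset
  have h := closure_convexHull_extremePoints (hV.isCompact_convexHull ℝ) (convex_convexHull ℝ V)
  rwa [(hfin.isCompact_convexHull ℝ).isClosed.closure_eq] at h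

lemma IsPolytope3.isCompact {P : Set E3} (hP : IsPolytope3 P) : IsCompact P := by
  obtain ⟨⟨V, hV, rfl⟩, -⟩ := hP
  exact hV.isCompact_convexHull ℝ

lemma IsPolytope3.convex {P : Set E3} (hP : IsPolytope3 P) : Convex ℝ P := by
  obtain ⟨⟨V, hV, rfl⟩, -⟩ := hP
  exact convex_convexHull ℝ V

lemma IsPolytope3.finite_extremePoints {P : Set E3} (hP : IsPolytope3 P) :
    (P.extremePoints ℝ).Finite := by
  obtain ⟨⟨V, hV, rfl⟩, -⟩ := hP
  exact hV.subset extremePoints_convexHull_subset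

lemma IsPolytope3.convexHull_extremePoints {P : Set E3} (hP : IsPolytope3 P) :
    convexHull ℝ (P.extremePoints ℝ) = P := by
  obtain ⟨⟨V, hV, rfl⟩, -⟩ := hP
  exact convexHull_extremePoints_eq hV

/-- An exposed face of a polytope is the convex hull of the vertices it contains. -/
lemma IsPolytope3.convexHull_inter_extremePoints {P F : Set E3} (hP : IsPolytope3 P)
    (hF : IsExposed ℝ P F) : convexHull ℝ (F ∩ P.extremePoints ℝ) = F := by
  have hfin : (F ∩ P.extremePoints ℝ).Finite := hP.finite_extremePoints.subset inter_subset_right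
  have h := closure_convexHull_extremePoints (hF.isCompact hP.isCompact) (hF.convex hP.convex)
  rwa [hF.isExtreme.extremePoints_eq, (hfin.isCompact_convexHull ℝ).isClosed.closure_eq] at h

/-- A vertex of the convex hull of a finite set is strictly separated from the other points. -/
lemma exists_lt_of_mem_extremePoints {V : Set E3} (hV : V.Finite) {v : E3}
    (hv : v ∈ (convexHull ℝ V).extremePoints ℝ) :
    ∃ l : E3 →L[ℝ] ℝ, ∀ w ∈ V, w ≠ v → l w < l v := by
  have hnot : v ∉ convexHull ℝ (V \ {v}) := fun h => by
    have h' := inter_extremePoints_subset_extremePoints_of_subset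
      (convexHull_mono (𝕜 := ℝ) (sdiff_subset (s := V) (t := {v}))) ⟨h, hv⟩
    exact (extremePoints_convexHull_subset h').2 rfl
  obtain ⟨f, u, hf, hu⟩ := geometric_hahn_banach_closed_point (convex_convexHull ℝ _)
    ((hV.subset sdiff_subset).isCompact_convexHull ℝ).isClosed hnot
  exact ⟨f, fun w hw hwv => (hf w (subset_convexHull ℝ _ ⟨hw, hwv⟩)).trans hu⟩

lemma le_of_mem_convexHull {V : Set E3} {l : E3 →L[ℝ] ℝ} {c : ℝ} (h : ∀ w ∈ V, l w ≤ c)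
    {y : E3} (hy : y ∈ convexHull ℝ V) : l y ≤ c :=
  convexHull_min (t := {z | l z ≤ c}) h (convex_halfSpace_le l.toLinearMap.isLinear c) hy

/-- If a linear functional is not maximal at a vertex `v` of a polytope, it increases along an edge
of the polytope issuing from `v`. -/
lemma exists_edge_of_lt {P : Set E3} (hP : IsPolytope3 P) {v : E3} (hv : v ∈ P.extremePoints ℝ)
    (l : E3 →L[ℝ] ℝ) {y : E3} (hy : y ∈ P) (hly : l v < l y) :
    ∃ (u : E3) (F : Set E3), IsEdge P F ∧ v ∈ F ∧ (∀ z ∈ F, ∃ t : ℝ, 0 ≤ t ∧ z = v + t • u) ∧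
      (∃ t : ℝ, 0 < t ∧ v + t • u ∈ F) ∧ 0 < l u := by
  set V := P.extremePoints ℝ with hVdef
  have hV : V.Finite := hP.finite_extremePoints
  have hPV : convexHull ℝ V = P := hP.convexHull_extremePoints
  have hVP : V ⊆ P := extremePoints_subset
  obtain ⟨g, hg⟩ := exists_lt_of_mem_extremePoints hV (v := v) (by rw [hPV]; exact hv)
  -- The scaling places all directions from `v` in the plane `g = -1`. Their convex hull is the
  -- vertex figure at `v`, whose extreme points are the edge directions.
  set dir : E3 → E3 := fun w => (g v - g w)⁻¹ • (w - v) with hdir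
  set D : Set E3 := dir '' (V \ {v}) with hD
  have hDfin : D.Finite := (hV.subset sdiff_subset).image _
  have hpos : ∀ w ∈ V, w ≠ v → 0 < g v - g w := fun w hw hwv => sub_pos.2 (hg w hw hwv)
  have hw_eq : ∀ w ∈ V, w ≠ v → w = v + (g v - g w) • dir w := fun w hw hwv => by
    simp only [hdir]
    rw [smul_smul, mul_inv_cancel₀ (hpos w hw hwv).ne', one_smul]; abel
  obtain ⟨w₁, hw₁V, hw₁⟩ : ∃ w ∈ V, l v < l w := by
    by_contra! hcon
    exact hly.not_ge (le_of_mem_convexHull hcon (by rwa [hPV]))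
  have hw₁v : w₁ ≠ v := fun h => by rw [h] at hw₁; exact lt_irrefl _ hw₁
  obtain ⟨u, huE, hu⟩ : ∃ u ∈ (convexHull ℝ D).extremePoints ℝ, 0 < l u := by
    by_contra! hcon
    have h1 : dir w₁ ∈ convexHull ℝ ((convexHull ℝ D).extremePoints ℝ) := by
      rw [convexHull_extremePoints_eq hDfin]
      exact subset_convexHull ℝ _ ⟨w₁, ⟨hw₁V, hw₁v⟩, rfl⟩
    have h2 := le_of_mem_convexHull hcon h1
    have h3 : 0 < l (dir w₁) := by
      simp only [hdir, map_smul, map_sub, smul_eq_mul]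
      exact mul_pos (inv_pos.2 (hpos w₁ hw₁V hw₁v)) (sub_pos.2 hw₁)
    exact h3.not_ge h2
  obtain ⟨h, hh⟩ := exists_lt_of_mem_extremePoints hDfin huE
  obtain ⟨w₀, ⟨hw₀V, hw₀v⟩, hw₀u⟩ := extremePoints_convexHull_subset huE
  have hw₀v : w₀ ≠ v := hw₀v
  -- Since `g` is `-1` on the vertex figure, `φ` equals `h - h u` there: zero at `u` and negative at
  -- the other directions. Hence `φ` exposes the edge along `u`.
  set φ : E3 →L[ℝ] ℝ := h + h u • g with hφ
  have hgdir : ∀ w ∈ V, w ≠ v → g (dir w) = -1 := fun w hw hwv => by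
    simp only [hdir, map_smul, map_sub, smul_eq_mul]
    have := (hpos w hw hwv).ne'
    field_simp; ring
  have hφw : ∀ w ∈ V, w ≠ v → φ w = φ v + (g v - g w) * (h (dir w) - h u) := fun w hw hwv => by
    conv_lhs => rw [hw_eq w hw hwv]
    rw [map_add, map_smul, smul_eq_mul]
    simp only [hφ, add_apply, smul_apply, smul_eq_mul]
    rw [hgdir w hw hwv]; ring
  have hφV : ∀ w ∈ V, φ w ≤ φ v := fun w hw => by
    by_cases hwv : w = v
    · rw [hwv]
    · rw [hφw w hw hwv]
      have h1 : h (dir w) ≤ h u := by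
        by_cases hdu : dir w = u
        · rw [hdu]
        · exact (hh _ ⟨w, ⟨hw, hwv⟩, rfl⟩ hdu).le
      nlinarith [hpos w hw hwv]
  have hφP : ∀ z ∈ P, φ z ≤ φ v := fun z hz => le_of_mem_convexHull hφV (by rwa [hPV])
  set F : Set E3 := {x | x ∈ P ∧ ∀ z ∈ P, φ z ≤ φ x} with hF
  have hFexp : IsExposed ℝ P F := fun _ => ⟨φ, rfl⟩
  have hvF : v ∈ F := ⟨hv.1, hφP⟩
  set ray : Set E3 := (fun t : ℝ => v + t • u) '' Ici 0 with hray
  have hrayc : Convex ℝ ray := by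
    have : ray = (AffineMap.lineMap v (v + u) : ℝ →ᵃ[ℝ] E3) '' Ici 0 := by
      simp only [hray]
      congr 1
      ext1 t
      simp [AffineMap.lineMap_apply, add_comm]
    rw [this]
    exact (convex_Ici 0).affine_image _
  have hFray : F ⊆ ray := by
    rw [← hP.convexHull_inter_extremePoints hFexp]
    refine convexHull_min ?_ hrayc
    rintro w ⟨hwF, hwV⟩
    by_cases hwv : w = v
    · exact ⟨0, by simp, by simp [hwv]⟩
    · have h1 : φ w = φ v := le_antisymm (hφV w hwV) (hwF.2 v hv.1)
      have h2 : dir w = u := by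
        by_contra hdu
        have := hh _ ⟨w, ⟨hwV, hwv⟩, rfl⟩ hdu
        have := hφw w hwV hwv
        nlinarith [hpos w hwV hwv]
      exact ⟨g v - g w, (hpos w hwV hwv).le, by
        have := hw_eq w hwV hwv
        rw [h2] at this
        exact this.symm⟩
  have hw₀F : v + (g v - g w₀) • u ∈ F := by
    rw [← hw₀u, ← hw_eq w₀ hw₀V hw₀v]
    refine ⟨hVP hw₀V, fun z hz => ?_⟩
    rw [hφw w₀ hw₀V hw₀v, hw₀u, sub_self, mul_zero, add_zero]
    exact hφP z hz
  have hu0 : u ≠ 0 := fun h0 => by rw [h0, map_zero] at hu; exact lt_irrefl _ hu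
  have hspan : vectorSpan ℝ F = Submodule.span ℝ {u} := by
    apply le_antisymm
    · rw [vectorSpan_def, Submodule.span_le]
      rintro _ ⟨a, ha, b, hb, rfl⟩
      obtain ⟨s, -, rfl⟩ := hFray ha
      obtain ⟨t, -, rfl⟩ := hFray hb
      rw [SetLike.mem_coe, Submodule.mem_span_singleton]
      exact ⟨s - t, by simp [sub_smul]⟩
    · rw [Submodule.span_singleton_le_iff_mem]
      have h1 := vsub_mem_vectorSpan ℝ hw₀F hvF
      rw [vsub_eq_sub, add_sub_cancel_left] at h1
      have h2 := (vectorSpan ℝ F).smul_mem (g v - g w₀)⁻¹ h1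
      rwa [smul_smul, inv_mul_cancel₀ (hpos w₀ hw₀V hw₀v).ne', one_smul] at h2
  refine ⟨u, F, ⟨hFexp, ?_⟩, hvF, fun z hz => ?_, ⟨_, hpos w₀ hw₀V hw₀v, hw₀F⟩, hu⟩
  · rw [hspan]; exact finrank_span_singleton hu0
  · obtain ⟨t, ht, rfl⟩ := hFray hz
    exact ⟨t, ht, rfl⟩

/-! ### Edge-tangent polytopes -/

/-- The contact point of an edge of an edge-tangent polytope supports the polytope. -/
lemma inner_le_one_of_contact {K : Set E3} (hK : IsPolytope3 K)
    (ht : ∀ F : Set E3, IsEdge K F → IsTangentToSphere F) {e : Set E3} (he : IsEdge K e) {x : E3}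
    (hxe : x ∈ e) (hx : ‖x‖ = 1) (hxy : ∀ y ∈ e, inner ℝ x y = 1) {y : E3} (hy : y ∈ K) :
    inner ℝ x y ≤ 1 := by
  obtain ⟨v, hv⟩ := (he.1.isCompact hK.isCompact).extremePoints_nonempty ⟨x, hxe⟩
  rw [he.1.isExtreme.extremePoints_eq] at hv
  obtain ⟨hve, hvK⟩ := hv
  have hxv := hxy v hve
  by_contra! hlt
  obtain ⟨u, F, hF, hvF, hFray, ⟨t, htpos, htF⟩, hu⟩ :=
    exists_edge_of_lt hK hvK (innerSL ℝ x) hy (by simpa [hxv] using hlt)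
  rw [innerSL_apply_apply] at hu
  obtain ⟨z, hzF, hz, hzy⟩ := ht F hF
  obtain ⟨τ, hτ, hzv⟩ := hFray z hzF
  have h1 : inner ℝ x z ≤ 1 := by
    have := real_inner_le_norm x z
    rwa [hx, hz, one_mul] at this
  rw [hzv, inner_add_right, inner_smul_right, hxv] at h1
  -- The contact point `z` of the new edge lies in the ball, so it cannot be strictly beyond the
  -- tangent plane at `x`. This forces `z = v = x`, and then the new edge lies in that plane,
  -- although `⟪x, ·⟫` increases along it.
  have hτ0 : τ = 0 := by nlinarith
  rw [hτ0, zero_smul, add_zero] at hzv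
  subst hzv
  have hxz : x = z := (inner_eq_one_iff_of_norm_eq_one (𝕜 := ℝ) hx hz).1 hxv
  have h2 := hzy _ htF
  rw [inner_add_right, inner_smul_right, ← hxz, real_inner_self_eq_norm_sq, hx] at h2
  nlinarith [mul_pos htpos hu]

/-- The interior of an edge-tangent polytope meets the open unit ball. -/
lemma exists_mem_interior_norm_lt_one {K : Set E3} (hK : IsPolytope3 K)
    (ht : ∀ F : Set E3, IsEdge K F → IsTangentToSphere F) :
    ∃ q ∈ interior K, ‖q‖ < 1 := by
  have key : ∀ v ∈ K.extremePoints ℝ, ∀ l : E3 →L[ℝ] ℝ, ∀ y ∈ K, l v < l y →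
      ∃ z ∈ K, ‖z‖ = 1 ∧ inner ℝ z v = 1 := fun v hv l y hy hly => by
    obtain ⟨u, F, hF, hvF, -⟩ := exists_edge_of_lt hK hv l hy hly
    obtain ⟨z, hzF, hz, hzy⟩ := ht F hF
    exact ⟨z, hF.1.subset hzF, hz, hzy v hvF⟩
  have hnotplane : ∀ l : E3 →L[ℝ] ℝ, l ≠ 0 → ∀ c : ℝ, ∃ y ∈ K, l y ≠ c := fun l hl c => by
    by_contra! hcon
    obtain ⟨q, hq⟩ := hK.2
    apply hl
    ext d
    have hev : ∀ᶠ t : ℝ in 𝓝 0, q + t • d ∈ K := by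
      have : Tendsto (fun t : ℝ => q + t • d) (𝓝 0) (𝓝 q) := by
        have hc : Continuous (fun t : ℝ => q + t • d) := by fun_prop
        simpa using hc.tendsto 0
      exact this (mem_interior_iff_mem_nhds.1 hq)
    obtain ⟨t, htK, ht0⟩ := ((hev.filter_mono nhdsWithin_le_nhds).and
      (self_mem_nhdsWithin (s := Ioi (0 : ℝ)))).exists
    have h1 := hcon _ htK
    rw [map_add, map_smul, hcon q (interior_subset hq), smul_eq_mul] at h1
    have h2 : t * l d = 0 := by linarith
    simpa [(show t ≠ 0 from (mem_Ioi.1 ht0).ne')] using h2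
  have key' : ∀ v ∈ K.extremePoints ℝ, ∃ z ∈ K, ‖z‖ = 1 ∧ inner ℝ z v = 1 := fun v hv => by
    obtain ⟨i⟩ : Nonempty (Fin 3) := inferInstance
    set b : E3 := EuclideanSpace.single i 1 with hb
    have hl : innerSL ℝ b ≠ 0 := fun h => by
      have := congrArg (fun f : E3 →L[ℝ] ℝ => f b) h
      simp [hb] at this
    obtain ⟨y, hy, hne⟩ := hnotplane _ hl (innerSL ℝ b v)
    rcases hne.lt_or_gt with h | h
    · exact key v hv (-innerSL ℝ b) y hy (by simpa using h)
    · exact key v hv _ y hy h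
  have hne : K.Nonempty := hK.2.mono interior_subset
  obtain ⟨v₀, hv₀⟩ := hK.isCompact.extremePoints_nonempty hne
  obtain ⟨x, hxK, hx, -⟩ := key' v₀ hv₀
  obtain ⟨v, hv, hvx⟩ : ∃ v ∈ K.extremePoints ℝ, inner ℝ x v ≠ 1 := by
    by_contra! hcon
    have hl : innerSL ℝ x ≠ 0 := fun h => by
      have := congrArg (fun f : E3 →L[ℝ] ℝ => f x) h
      simp [hx] at this
    obtain ⟨y, hy, hne⟩ := hnotplane _ hl 1
    rw [← hK.convexHull_extremePoints] at hy
    apply hne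
    apply le_antisymm
    · exact le_of_mem_convexHull (fun w hw => (hcon w hw).le) hy
    · have := le_of_mem_convexHull (l := -innerSL ℝ x) (c := -1)
        (fun w hw => by simp [hcon w hw]) hy
      simpa using this
  obtain ⟨z, hzK, hz, hzv⟩ := key' v hv
  have hxz : x ≠ z := fun h => hvx (h ▸ hzv)
  -- The contact points `x` and `z` differ because `v` lies on the tangent plane at `z` but not on
  -- the one at `x`. By strict convexity their midpoint is inside the open ball.
  have hmK : midpoint ℝ x z ∈ closure (interior K) := by
    rw [hK.convex.closure_interior_eq_closure_of_nonempty_interior hK.2]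
    exact subset_closure (hK.convex.midpoint_mem hxK hzK)
  have hm : ‖midpoint ℝ x z‖ < 1 := by
    have h1 : inner ℝ x z < 1 := by
      have hle := real_inner_le_norm x z
      rw [hx, hz, one_mul] at hle
      exact lt_of_le_of_ne hle fun h => hxz ((inner_eq_one_iff_of_norm_eq_one (𝕜 := ℝ) hx hz).1 h)
    have h2 : ‖x + z‖ ^ 2 < 2 ^ 2 := by
      rw [norm_add_sq_real, hx, hz]; linarith
    have h3 : ‖x + z‖ < 2 := lt_of_pow_lt_pow_left₀ 2 (by norm_num) h2
    rw [midpoint_eq_smul_add, norm_smul]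
    norm_num
    linarith
  obtain ⟨q, hq1, hq2⟩ := mem_closure_iff.1 hmK (Metric.ball 0 1) Metric.isOpen_ball (by simpa using hm)
  exact ⟨q, hq2, by simpa using hq1⟩

/-! ### Affine equivalences -/

lemma isExposed_image (Ψ : E3 ≃ᵃ[ℝ] E3) {P F : Set E3} (h : IsExposed ℝ P F) :
    IsExposed ℝ (Ψ '' P) (Ψ '' F) := by
  intro hne
  obtain ⟨l, hl⟩ := h hne.of_image
  set m : E3 →L[ℝ] ℝ := LinearMap.toContinuousLinearMap
    (l.toLinearMap ∘ₗ Ψ.linear.symm.toLinearMap) with hm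
  have hml : ∀ x y, m (Ψ x) ≤ m (Ψ y) ↔ l x ≤ l y := fun x y => by
    rw [← sub_nonneg, ← map_sub, ← vsub_eq_sub, ← AffineEquiv.coe_toAffineMap,
      ← AffineMap.linearMap_vsub]
    simp [hm]
  refine ⟨m, ?_⟩
  rw [hl]
  ext z
  constructor
  · rintro ⟨x, ⟨hx, hxm⟩, rfl⟩
    refine ⟨⟨x, hx, rfl⟩, ?_⟩
    rintro _ ⟨y, hy, rfl⟩
    exact (hml y x).2 (hxm y hy)
  · rintro ⟨⟨x, hx, rfl⟩, hxm⟩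
    exact ⟨x, ⟨hx, fun y hy => (hml y x).1 (hxm _ ⟨y, hy, rfl⟩)⟩, rfl⟩

lemma symm_image_image (Ψ : E3 ≃ᵃ[ℝ] E3) (S : Set E3) : Ψ.symm '' (Ψ '' S) = S := by
  rw [image_image]; simp

lemma image_symm_image (Ψ : E3 ≃ᵃ[ℝ] E3) (S : Set E3) : Ψ '' (Ψ.symm '' S) = S := by
  rw [image_image]; simp

lemma isExposed_symm_image (Ψ : E3 ≃ᵃ[ℝ] E3) {P F : Set E3} (h : IsExposed ℝ (Ψ '' P) F) :
    IsExposed ℝ P (Ψ.symm '' F) := by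
  have := isExposed_image Ψ.symm h
  rwa [symm_image_image] at this

lemma combEquiv_image (Ψ : E3 ≃ᵃ[ℝ] E3) (P : Set E3) : CombEquiv P (Ψ '' P) :=
  ⟨{ toFun := fun F => ⟨Ψ '' F.1, isExposed_image Ψ F.2⟩
     invFun := fun F => ⟨Ψ.symm '' F.1, isExposed_symm_image Ψ F.2⟩
     left_inv := fun F => Subtype.ext (symm_image_image Ψ F.1)
     right_inv := fun F => Subtype.ext (image_symm_image Ψ F.1)
     map_rel_iff' := image_subset_image_iff (f := Ψ) Ψ.injective }⟩

lemma isPolytope3_image (Ψ : E3 ≃ᵃ[ℝ] E3) {P : Set E3} (hP : IsPolytope3 P) :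
    IsPolytope3 (Ψ '' P) := by
  obtain ⟨⟨V, hV, rfl⟩, hne⟩ := hP
  refine ⟨⟨Ψ '' V, hV.image _, Ψ.toAffineMap.image_convexHull V⟩, ?_⟩
  have h := (AffineEquiv.toContinuousAffineEquiv Ψ).toHomeomorph.image_interior (convexHull ℝ V)
  exact (hne.image _).mono h.subset

lemma isEdge_symm_image (Ψ : E3 ≃ᵃ[ℝ] E3) {P F : Set E3} (h : IsEdge (Ψ '' P) F) :
    IsEdge P (Ψ.symm '' F) := by
  refine ⟨isExposed_symm_image Ψ h.1, ?_⟩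
  have h1 := Ψ.symm.toAffineMap.map_vectorSpan (s := F)
  rw [AffineEquiv.coe_toAffineMap] at h1
  rw [← h1, ← h.2]
  exact LinearEquiv.finrank_map_eq Ψ.symm.linear _

lemma extremePoints_image (Ψ : E3 ≃ᵃ[ℝ] E3) (P : Set E3) :
    (Ψ '' P).extremePoints ℝ ⊆ Ψ '' P.extremePoints ℝ := by
  rintro _ ⟨⟨x, hx, rfl⟩, hext⟩
  refine ⟨x, ⟨hx, fun y hy z hz hxyz => ?_⟩, rfl⟩
  refine Ψ.injective (hext ⟨y, hy, rfl⟩ ⟨z, hz, rfl⟩ ?_)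
  have h := image_openSegment ℝ Ψ.toAffineMap y z
  rw [AffineEquiv.coe_toAffineMap] at h
  rw [← h]
  exact ⟨x, hxyz, rfl⟩

lemma CombEquiv.symm {P Q : Set E3} (h : CombEquiv P Q) : CombEquiv Q P := h.map OrderIso.symm

lemma CombEquiv.trans {P Q R : Set E3} (h : CombEquiv P Q) (h' : CombEquiv Q R) : CombEquiv P R :=
  h.elim fun f => h'.map fun g => f.trans g

/-! ### Polarity -/

lemma mem_polar_convexHull {V : Set E3} {a : E3} :
    a ∈ polar (convexHull ℝ V) ↔ ∀ v ∈ V, inner ℝ a v ≤ 1 :=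
  ⟨fun h v hv => h v (subset_convexHull ℝ V hv),
    fun h _ hy => le_of_mem_convexHull (l := innerSL ℝ a) h hy⟩

lemma IsPolytope3.mem_polar {P : Set E3} (hP : IsPolytope3 P) {a : E3} :
    a ∈ polar P ↔ ∀ v ∈ P.extremePoints ℝ, inner ℝ a v ≤ 1 := by
  rw [← mem_polar_convexHull, hP.convexHull_extremePoints]

lemma eventually_inner_add_smul_le {α d v : E3} (h : inner ℝ α v < 1 ∨ inner ℝ d v = 0)
    (hα : inner ℝ α v ≤ 1) : ∀ᶠ t : ℝ in 𝓝 0, inner ℝ (α + t • d) v ≤ 1 := by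
  simp only [inner_add_left, real_inner_smul_left]
  rcases h with h | h
  · have hc : Continuous fun t : ℝ => inner ℝ α v + t * inner ℝ d v := by fun_prop
    have ht := hc.tendsto 0
    simp only [zero_mul, add_zero] at ht
    exact (ht.eventually (gt_mem_nhds h)).mono fun t ht => ht.le
  · simp [h, hα]

/-- A vertex of the polar of a polytope is determined by the constraints active at it. -/
lemma eq_of_mem_extremePoints_polar {V : Set E3} (hV : V.Finite) {α β : E3}
    (hα : α ∈ (polar (convexHull ℝ V)).extremePoints ℝ)
    (h : ∀ v ∈ V, inner ℝ α v = 1 → inner ℝ β v = 1) : β = α := by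
  have hα1 := mem_polar_convexHull.1 hα.1
  have hev : ∀ d : E3, (∀ v ∈ V, inner ℝ α v = 1 → inner ℝ d v = 0) →
      ∀ᶠ t : ℝ in 𝓝[>] 0, α + t • d ∈ polar (convexHull ℝ V) := fun d hd => by
    simp only [mem_polar_convexHull]
    refine Eventually.filter_mono nhdsWithin_le_nhds ((eventually_all_finite hV).2 fun v hv => ?_)
    refine eventually_inner_add_smul_le ?_ (hα1 v hv)
    rcases (hα1 v hv).lt_or_eq with h1 | h1
    · exact Or.inl h1
    · exact Or.inr (hd v hv h1)
  have h0 : ∀ v ∈ V, inner ℝ α v = 1 → inner ℝ (β - α) v = 0 := fun v hv h1 => by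
    rw [inner_sub_left, h v hv h1, h1, sub_self]
  -- Small steps along both `β - α` and its negative stay in the polar, so `α` is the midpoint of a
  -- segment there.
  obtain ⟨t, ⟨ht1, ht2⟩, ht0⟩ := (((hev _ h0).and (hev (-(β - α)) fun v hv h1 => by
    rw [inner_neg_left, h0 v hv h1, neg_zero])).and self_mem_nhdsWithin).exists
  have h2 : α + t • (β - α) = α := hα.2 ht1 ht2
    ⟨1 / 2, 1 / 2, by norm_num, by norm_num, by norm_num, by module⟩
  have h3 : t • (β - α) = 0 := by simpa using h2
  exact sub_eq_zero.1 ((smul_eq_zero.1 h3).resolve_left (mem_Ioi.1 ht0).ne')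

lemma convex_polar (P : Set E3) : Convex ℝ (polar P) := by
  have : polar P = ⋂ v ∈ P, {a | inner ℝ a v ≤ 1} := by ext; simp [polar]
  rw [this]
  refine convex_iInter₂ fun v _ => ?_
  have := convex_halfSpace_le (innerSL ℝ v).toLinearMap.isLinear 1
  simpa [real_inner_comm] using this

lemma isClosed_polar (P : Set E3) : IsClosed (polar P) := by
  have : polar P = ⋂ v ∈ P, {a | inner ℝ a v ≤ 1} := by ext; simp [polar]
  rw [this]
  exact isClosed_biInter fun v _ => isClosed_le (by fun_prop) continuous_const

lemma isCompact_polar {P : Set E3} (h0 : (0 : E3) ∈ interior P) : IsCompact (polar P) := by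
  refine Metric.isCompact_of_isClosed_isBounded (isClosed_polar P) ?_
  obtain ⟨r, hr, hrP⟩ := Metric.nhds_basis_closedBall.mem_iff.1 (mem_interior_iff_mem_nhds.1 h0)
  refine (Metric.isBounded_closedBall (x := (0 : E3)) (r := 1 / r)).subset fun a ha => ?_
  rw [mem_closedBall_zero_iff, le_div_iff₀ hr]
  by_cases ha0 : a = 0
  · simp [ha0]
  have hn : 0 < ‖a‖ := norm_pos_iff.2 ha0
  have h1 := ha ((r / ‖a‖) • a) (hrP (by
    rw [mem_closedBall_zero_iff, norm_smul, Real.norm_of_nonneg (by positivity)]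
    field_simp; exact le_rfl))
  rw [real_inner_smul_right, real_inner_self_eq_norm_sq] at h1
  calc ‖a‖ * r = r / ‖a‖ * ‖a‖ ^ 2 := by field_simp
    _ ≤ 1 := h1

lemma IsPolytope3.zero_mem_interior_polar {P : Set E3} (hP : IsPolytope3 P) :
    (0 : E3) ∈ interior (polar P) := by
  rw [mem_interior_iff_mem_nhds]
  have : ∀ᶠ a : E3 in 𝓝 0, ∀ v ∈ P.extremePoints ℝ, inner ℝ a v ≤ 1 := by
    refine (eventually_all_finite hP.finite_extremePoints).2 fun v _ => ?_
    have hc : Continuous fun a : E3 => inner ℝ a v := by fun_prop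
    have ht := hc.tendsto 0
    rw [inner_zero_left] at ht
    exact (ht.eventually (gt_mem_nhds one_pos)).mono fun a h => h.le
  exact this.mono fun a ha => hP.mem_polar.2 ha

/-- A vertex of the polar is determined by the set of vertices of `P` active at it, and there are
finitely many such sets; Krein–Milman does the rest. -/
lemma IsPolytope3.polar {P : Set E3} (hP : IsPolytope3 P) (h0 : (0 : E3) ∈ interior P) :
    IsPolytope3 (polar P) := by
  have hfin : ((Koebe.polar P).extremePoints ℝ).Finite := by
    refine Finite.of_finite_image (f := fun α => {v ∈ P.extremePoints ℝ | inner ℝ α v = 1}) ?_ ?_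
    · refine hP.finite_extremePoints.finite_subsets.subset ?_
      rintro _ ⟨α, -, rfl⟩
      exact sep_subset _ _
    · intro α hα β hβ hαβ
      rw [← hP.convexHull_extremePoints] at hβ
      exact eq_of_mem_extremePoints_polar hP.finite_extremePoints hβ fun v hv hv1 =>
        ((Set.ext_iff.1 hαβ v).2 ⟨hv, hv1⟩).2
  have h := closure_convexHull_extremePoints (isCompact_polar h0) (convex_polar P)
  rw [(hfin.isCompact_convexHull ℝ).isClosed.closure_eq] at h
  exact ⟨⟨_, hfin, h.symm⟩, ⟨0, hP.zero_mem_interior_polar⟩⟩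

/-- Every continuous linear functional is an inner product. -/
lemma exists_inner_eq (l : E3 →L[ℝ] ℝ) : ∃ a : E3, ∀ y, inner ℝ a y = l y :=
  ⟨(InnerProductSpace.toDual ℝ E3).symm l, fun _ => InnerProductSpace.toDual_symm_apply⟩

lemma polar_polar {P : Set E3} (hc : Convex ℝ P) (hcl : IsClosed P) (h0 : (0 : E3) ∈ P) :
    polar (polar P) = P := by
  apply Subset.antisymm
  · intro x hx
    by_contra hxP
    obtain ⟨f, s, hf, hs⟩ := geometric_hahn_banach_closed_point hc hcl hxP
    obtain ⟨a, ha⟩ := exists_inner_eq f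
    have hs0 : 0 < s := by simpa using hf 0 h0
    have h1 : s⁻¹ • a ∈ polar P := fun y hy => by
      rw [real_inner_smul_left, ha, inv_mul_le_iff₀ hs0, mul_one]
      exact (hf y hy).le
    have h2 := hx _ h1
    rw [real_inner_comm, real_inner_smul_left, ha, inv_mul_le_iff₀ hs0, mul_one] at h2
    exact hs.not_ge h2
  · intro x hx a ha
    rw [real_inner_comm]
    exact ha x hx

lemma IsPolytope3.polar_polar {P : Set E3} (hP : IsPolytope3 P) (h0 : (0 : E3) ∈ interior P) :
    Koebe.polar (Koebe.polar P) = P :=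
  Koebe.polar_polar hP.convex hP.isCompact.isClosed (interior_subset h0)

/-- The face of the polar of `P` dual to `F`. -/
def dualFace (P F : Set E3) : Set E3 := {a | a ∈ polar P ∧ ∀ y ∈ F, inner ℝ a y = 1}

lemma dualFace_anti (P : Set E3) {F G : Set E3} (h : F ⊆ G) : dualFace P G ⊆ dualFace P F :=
  fun _ ha => ⟨ha.1, fun y hy => ha.2 y (h hy)⟩

/-- The sum of the vertices of `F` is an exposing functional: each summand is at most 1 on the
polar, so the sum reaches its bound only where all are 1. -/
lemma isExposed_dualFace {P F : Set E3} (hP : IsPolytope3 P) (hF : IsExposed ℝ P F) :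
    IsExposed ℝ (polar P) (dualFace P F) := by
  rintro ⟨a₀, ha₀⟩
  set W := F ∩ P.extremePoints ℝ with hW
  have hWfin : W.Finite := hP.finite_extremePoints.subset inter_subset_right
  have hWF : convexHull ℝ W = F := hP.convexHull_inter_extremePoints hF
  set T := hWfin.toFinset with hT
  have hTW : ∀ v, v ∈ T ↔ v ∈ W := fun v => hWfin.mem_toFinset
  have hsum : ∀ a, innerSL ℝ (∑ v ∈ T, v) a = ∑ v ∈ T, inner ℝ a v := fun a => by
    rw [innerSL_apply_apply, sum_inner]
    exact Finset.sum_congr rfl fun v _ => real_inner_comm _ _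
  have hle : ∀ a ∈ polar P, ∀ v ∈ T, inner ℝ a v ≤ 1 := fun a ha v hv =>
    ha v (((hTW v).1 hv).2.1)
  have hmem : ∀ a ∈ polar P, (a ∈ dualFace P F ↔ ∑ v ∈ T, inner ℝ a v = ∑ v ∈ T, (1 : ℝ)) :=
    fun a ha => by
      rw [Finset.sum_eq_sum_iff_of_le (hle a ha)]
      constructor
      · intro h v hv
        exact h.2 v ((hTW v).1 hv).1
      · intro h
        refine ⟨ha, fun y hy => ?_⟩
        rw [← hWF] at hy
        apply le_antisymm
        · exact le_of_mem_convexHull (l := innerSL ℝ a) (fun w hw => (h w ((hTW w).2 hw)).le) hy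
        · have := le_of_mem_convexHull (l := -innerSL ℝ a) (c := -1)
            (fun w hw => by simp [h w ((hTW w).2 hw)]) hy
          simpa using this
  refine ⟨innerSL ℝ (∑ v ∈ T, v), ?_⟩
  ext a
  simp only [hsum, mem_ofPred_eq]
  constructor
  · intro ha
    refine ⟨ha.1, fun b hb => ?_⟩
    rw [(hmem a ha.1).1 ha]
    exact Finset.sum_le_sum (hle b hb)
  · rintro ⟨ha, hmax⟩
    rw [hmem a ha]
    apply le_antisymm (Finset.sum_le_sum (hle a ha))
    rw [← (hmem a₀ ha₀.1).1 ha₀]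
    exact hmax a₀ ha₀.1

lemma map_nonpos_of_nonpos_on_nhds {P : Set E3} (h0 : (0 : E3) ∈ interior P) {l : E3 →L[ℝ] ℝ}
    (hl : ∀ y ∈ P, l y ≤ 0) (d : E3) : l d ≤ 0 := by
  have hc : Continuous (fun t : ℝ => t • d) := by fun_prop
  have ht := hc.tendsto 0
  rw [zero_smul] at ht
  have hev : ∀ᶠ t : ℝ in 𝓝 0, t • d ∈ P := ht (mem_interior_iff_mem_nhds.1 h0)
  obtain ⟨t, htP, ht0⟩ := ((hev.filter_mono nhdsWithin_le_nhds).and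
    (self_mem_nhdsWithin (s := Ioi (0 : ℝ)))).exists
  have h1 : l (t • d) ≤ 0 := hl _ htP
  rw [map_smul, smul_eq_mul] at h1
  exact nonpos_of_mul_nonpos_right h1 ht0

lemma dualFace_dualFace {P F : Set E3} (hP : IsPolytope3 P) (h0 : (0 : E3) ∈ interior P)
    (hF : IsExposed ℝ P F) : dualFace (polar P) (dualFace P F) = F := by
  have h0P : (0 : E3) ∈ P := interior_subset h0
  have h0P' : (0 : E3) ∈ polar P := interior_subset hP.zero_mem_interior_polar
  have hFP : F ⊆ P := hF.subset
  have hsub : F ⊆ dualFace (polar P) (dualFace P F) := fun y hy =>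
    ⟨by rw [hP.polar_polar h0]; exact hFP hy, fun a ha => by rw [real_inner_comm]; exact ha.2 y hy⟩
  refine Subset.antisymm (fun y hy => ?_) hsub
  have hyP : y ∈ P := by rw [← hP.polar_polar h0]; exact hy.1
  rcases F.eq_empty_or_nonempty with rfl | ⟨x, hx⟩
  · have := hy.2 0 ⟨h0P', by simp⟩
    simp at this
  obtain ⟨l, hl⟩ := hF ⟨x, hx⟩
  have hx' := hx
  rw [hl] at hx' ⊢
  have hm : 0 ≤ l x := by simpa using hx'.2 0 h0P
  -- If the maximum is 0, then `l` vanishes and `F = P`. Otherwise `l` scaled to maximum 1 belongs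
  -- to the dual face and cuts out `F`.
  rcases hm.eq_or_lt with hm | hm
  · have h1 : ∀ d, l d ≤ 0 :=
      map_nonpos_of_nonpos_on_nhds h0 fun y hy => (hx'.2 y hy).trans hm.symm.le
    refine ⟨hyP, fun z _ => ?_⟩
    have := h1 (-y)
    rw [map_neg] at this
    linarith [h1 z]
  · obtain ⟨a, ha⟩ := exists_inner_eq l
    have h1 : (l x)⁻¹ • a ∈ dualFace P F := by
      refine ⟨fun z hz => ?_, fun z hz => ?_⟩
      · rw [real_inner_smul_left, ha, inv_mul_le_iff₀ hm, mul_one]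
        exact hx'.2 z hz
      · rw [hl] at hz
        rw [real_inner_smul_left, ha, le_antisymm (hx'.2 z hz.1) (hz.2 x hx'.1),
          inv_mul_cancel₀ hm.ne']
    have h2 := hy.2 _ h1
    rw [real_inner_comm, real_inner_smul_left, ha, inv_mul_eq_one₀ hm.ne'] at h2
    exact ⟨hyP, fun z hz => (hx'.2 z hz).trans h2.le⟩

/-- Polarity is an anti-isomorphism of face lattices. -/
def polarFaceEquiv {P : Set E3} (hP : IsPolytope3 P) (h0 : (0 : E3) ∈ interior P) :
    Face P ≃o (Face (polar P))ᵒᵈ where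
  toFun F := OrderDual.toDual ⟨dualFace P F.1, isExposed_dualFace hP F.2⟩
  invFun G := ⟨dualFace (polar P) (OrderDual.ofDual G).1, by
    have := isExposed_dualFace (hP.polar h0) (OrderDual.ofDual G).2
    rwa [hP.polar_polar h0] at this⟩
  left_inv F := Subtype.ext (dualFace_dualFace hP h0 F.2)
  right_inv G := by
    have h := dualFace_dualFace (hP.polar h0) hP.zero_mem_interior_polar (OrderDual.ofDual G).2
    rw [hP.polar_polar h0] at h
    exact congrArg OrderDual.toDual (Subtype.ext h)
  map_rel_iff' := by
    intro F G
    constructor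
    · intro h
      have h1 : dualFace P G.1 ⊆ dualFace P F.1 := h
      have h2 := dualFace_anti (polar P) h1
      rwa [dualFace_dualFace hP h0 F.2, dualFace_dualFace hP h0 G.2] at h2
    · intro h
      exact dualFace_anti P (show F.1 ⊆ G.1 from h)

lemma CombEquiv.polar {P R : Set E3} (hP : IsPolytope3 P) (hP0 : (0 : E3) ∈ interior P)
    (hR : IsPolytope3 R) (hR0 : (0 : E3) ∈ interior R) (h : CombEquiv P R) :
    CombEquiv (polar P) (polar R) :=
  h.map fun e => OrderIso.dual
    (((polarFaceEquiv hP hP0).symm.trans e).trans (polarFaceEquiv hR hR0)) |>.trans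
      (OrderIso.dualDual _).symm |> (OrderIso.dualDual _).trans

lemma finrank_E3 : Module.finrank ℝ E3 = 3 := by simp

/-- The exposing functional of `x`, scaled to be 1 at `x`, is below 1 at all other vertices, so it
can move slightly in every direction orthogonal to `x`. The dual of a vertex is thus too large to be
an edge. -/
lemma orthogonal_le_vectorSpan {P : Set E3} (hP : IsPolytope3 P) {x : E3} (hx0 : x ≠ 0)
    (h0 : (0 : E3) ∈ P) (hx : IsExposed ℝ P {x}) :
    (Submodule.span ℝ {x})ᗮ ≤ vectorSpan ℝ (dualFace P {x}) := by
  obtain ⟨l, hl⟩ := hx ⟨x, rfl⟩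
  have hxl : x ∈ P ∧ ∀ y ∈ P, l y ≤ l x := by
    have : x ∈ ({x} : Set E3) := rfl
    rwa [hl] at this
  have hlt : ∀ y ∈ P, y ≠ x → l y < l x := fun y hy hyx => by
    refine lt_of_le_of_ne (hxl.2 y hy) fun h => hyx ?_
    have : y ∈ ({x} : Set E3) := by
      rw [hl]; exact ⟨hy, fun z hz => (hxl.2 z hz).trans h.symm.le⟩
    exact this
  have hpos : 0 < l x := by simpa using hlt 0 h0 hx0.symm
  obtain ⟨a, ha⟩ := exists_inner_eq l
  set g := (l x)⁻¹ • a with hg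
  have hgy : ∀ y, inner ℝ g y = (l x)⁻¹ * l y := fun y => by
    rw [hg, real_inner_smul_left, ha]
  have hgx : inner ℝ g x = 1 := by rw [hgy, inv_mul_cancel₀ hpos.ne']
  have hgP : g ∈ polar P := fun y hy => by
    rw [hgy, inv_mul_le_iff₀ hpos, mul_one]; exact hxl.2 y hy
  intro d hd
  have hdx : inner ℝ d x = 0 := by
    rw [real_inner_comm]; exact Submodule.mem_orthogonal_singleton_iff_inner_right.1 hd
  have hev : ∀ᶠ t : ℝ in 𝓝 0, ∀ v ∈ P.extremePoints ℝ, inner ℝ (g + t • d) v ≤ 1 := by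
    refine (eventually_all_finite hP.finite_extremePoints).2 fun v hv => ?_
    refine eventually_inner_add_smul_le ?_ (hgP v hv.1)
    by_cases hvx : v = x
    · exact Or.inr (hvx ▸ hdx)
    · left
      rw [hgy, inv_mul_lt_iff₀ hpos, mul_one]
      exact hlt v hv.1 hvx
  obtain ⟨t, htP, ht0⟩ := ((hev.filter_mono nhdsWithin_le_nhds).and
    (self_mem_nhdsWithin (s := Ioi (0 : ℝ)))).exists
  have h1 : g + t • d ∈ dualFace P {x} := ⟨hP.mem_polar.2 htP, fun y hy => by
    rw [mem_singleton_iff.1 hy, inner_add_left, hgx, real_inner_smul_left, hdx]; simp⟩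
  have h2 : g ∈ dualFace P {x} := ⟨hgP, fun y hy => by rw [mem_singleton_iff.1 hy, hgx]⟩
  have h3 := vsub_mem_vectorSpan ℝ h1 h2
  rw [vsub_eq_sub, add_sub_cancel_left] at h3
  exact ((vectorSpan ℝ (dualFace P {x})).smul_mem_iff (mem_Ioi.1 ht0).ne').1 h3

/-- The face dual to an edge is an edge. -/
lemma isEdge_dualFace {P E : Set E3} (hP : IsPolytope3 P) (h0 : (0 : E3) ∈ interior P)
    (hE : IsEdge (polar P) E) :
    IsEdge P (dualFace (polar P) E) ∧ dualFace P (dualFace (polar P) E) = E := by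
  have hPP := hP.polar_polar h0
  have hP' := hP.polar h0
  have h0' := hP.zero_mem_interior_polar
  set e := dualFace (polar P) E with he
  have heE : dualFace P e = E := by
    have := dualFace_dualFace hP' h0' hE.1
    rwa [hPP] at this
  have hexp : IsExposed ℝ P e := by
    have := isExposed_dualFace hP' hE.1
    rwa [hPP] at this
  refine ⟨⟨hexp, ?_⟩, heE⟩
  obtain ⟨x, hx⟩ : e.Nonempty := by
    by_contra hne
    rw [not_nonempty_iff_eq_empty] at hne
    have h1 : E = polar P := by rw [← heE, hne]; ext; simp [dualFace]
    have h2 : vectorSpan ℝ E = ⊤ := by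
      rw [h1, ← direction_affineSpan, affineSpan_eq_top_of_nonempty_interior
        (by rw [(convex_polar P).convexHull_eq]; exact ⟨0, h0'⟩)]
      simp
    have h3 := hE.2
    rw [h2, finrank_top, finrank_E3] at h3
    norm_num at h3
  apply le_antisymm
  · have hns : ¬ E.Subsingleton := fun h => by
      have h1 := hE.2
      rw [(vectorSpan_eq_bot_iff_subsingleton ℝ).2 h, finrank_bot] at h1
      norm_num at h1
    obtain ⟨a, ha, b, hb, hab⟩ := not_subsingleton_iff.1 hns
    -- Distinct points pairing to 1 with `x` are independent; `e` varies only orthogonally to both,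
    -- leaving dimension at most one.
    have hli : LinearIndependent ℝ ![a, b] := by
      rw [LinearIndependent.pair_iff]
      intro s t hst
      have h1 := congrArg (inner ℝ x) hst
      rw [inner_add_right, inner_smul_right, inner_smul_right, hx.2 a ha, hx.2 b hb,
        inner_zero_right, mul_one, mul_one] at h1
      have ht : t = -s := by linarith
      rw [ht] at hst
      have h2 : s • (a - b) = 0 := by rw [← hst]; module
      have hs := (smul_eq_zero.1 h2).resolve_right (sub_ne_zero.2 hab)
      exact ⟨hs, by rw [ht, hs, neg_zero]⟩
    have hfr : Module.finrank ℝ (Submodule.span ℝ (range ![a, b])) = 2 := by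
      rw [finrank_span_eq_card hli]; simp
    have hle : vectorSpan ℝ e ≤ (Submodule.span ℝ (range ![a, b]))ᗮ := by
      rw [vectorSpan_def, Submodule.span_le]
      rintro _ ⟨y, hy, z, hz, rfl⟩
      rw [SetLike.mem_coe, Submodule.mem_orthogonal']
      intro u hu
      induction hu using Submodule.span_induction with
      | mem u hu =>
        obtain ⟨i, rfl⟩ := hu
        have hi : (![a, b] : Fin 2 → E3) i ∈ E := by fin_cases i <;> assumption
        simp only [vsub_eq_sub]
        rw [inner_sub_left, hy.2 _ hi, hz.2 _ hi, sub_self]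
      | zero => simp
      | add u v _ _ hu hv => rw [inner_add_right, hu, hv, add_zero]
      | smul c u _ hu => rw [inner_smul_right, hu, mul_zero]
    have h1 := Submodule.finrank_add_finrank_orthogonal (Submodule.span ℝ (range ![a, b]))
    have h2 := Submodule.finrank_mono hle
    rw [hfr, finrank_E3] at h1
    omega
  · by_contra hlt
    have hz : Module.finrank ℝ (vectorSpan ℝ e) = 0 := by omega
    have hsub := (vectorSpan_eq_bot_iff_subsingleton ℝ).1 (Submodule.finrank_eq_zero.1 hz)
    have hex : e = {x} := hsub.eq_singleton_of_mem hx
    obtain ⟨a, ha⟩ : E.Nonempty := by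
      by_contra hne
      rw [not_nonempty_iff_eq_empty] at hne
      have h1 := hE.2
      rw [hne, vectorSpan_empty, finrank_bot] at h1
      norm_num at h1
    have hx0 : x ≠ 0 := fun h => by
      have := hx.2 a ha
      rw [h, inner_zero_left] at this
      norm_num at this
    have h1 := Submodule.finrank_mono
      (orthogonal_le_vectorSpan hP hx0 (interior_subset h0) (hex ▸ hexp))
    rw [show dualFace P {x} = E by rw [← hex, heE], hE.2] at h1
    have h2 := Submodule.finrank_add_finrank_orthogonal (Submodule.span ℝ {x})
    rw [finrank_span_singleton hx0, finrank_E3] at h2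
    omega

lemma IsDual.symm {P Q : Set E3} (h : IsDual P Q) : IsDual Q P := by
  obtain ⟨R, hR, hRP, h0, hQ⟩ := h
  refine ⟨polar R, hR.polar h0, hQ.symm, hR.zero_mem_interior_polar, ?_⟩
  rw [hR.polar_polar h0]
  exact hRP.symm

/-! ### Rational normalization of the polar -/

/-- Points with rational coordinates. -/
def ratPoint (r : Fin 3 → ℚ) : E3 := WithLp.toLp 2 fun i => (r i : ℝ)

lemma denseRange_ratPoint : DenseRange ratPoint := by
  have h1 : DenseRange (Pi.map fun (_ : Fin 3) (q : ℚ) => (q : ℝ)) :=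
    DenseRange.piMap fun _ => Rat.denseRange_cast
  exact (PiLp.homeomorph 2 fun _ : Fin 3 => ℝ).symm.surjective.denseRange.comp h1
    (PiLp.homeomorph 2 fun _ : Fin 3 => ℝ).symm.continuous

/-- The image of the origin under the reflection in the point `a` of the projective model of
hyperbolic space. -/
noncomputable def center (a : E3) : E3 := (2 / (1 + ‖a‖ ^ 2)) • a

lemma continuous_center : Continuous center := by
  unfold center
  have h : Continuous fun a : E3 => 2 / (1 + ‖a‖ ^ 2) :=
    continuous_const.div (by fun_prop) fun a => by positivity
  exact h.smul continuous_id

lemma exists_center_eq {q : E3} (hq : ‖q‖ < 1) : ∃ a : E3, ‖a‖ < 1 ∧ center a = q := by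
  have h1 : 0 < 1 - ‖q‖ ^ 2 := by nlinarith [norm_nonneg q]
  set σ := √(1 - ‖q‖ ^ 2) with hσ
  have hσ0 : 0 < σ := Real.sqrt_pos.2 h1
  have hσ2 : σ ^ 2 = 1 - ‖q‖ ^ 2 := Real.sq_sqrt h1.le
  have hn : ‖(1 + σ)⁻¹ • q‖ = ‖q‖ / (1 + σ) := by
    rw [norm_smul, Real.norm_of_nonneg (by positivity)]; ring
  refine ⟨(1 + σ)⁻¹ • q, ?_, ?_⟩
  · rw [hn, div_lt_one (by positivity)]; linarith
  · rw [center, hn, smul_smul]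
    have : 2 / (1 + (‖q‖ / (1 + σ)) ^ 2) * (1 + σ)⁻¹ = 1 := by
      have h3 : 1 + (‖q‖ / (1 + σ)) ^ 2 = 2 / (1 + σ) := by
        field_simp; nlinarith
      rw [h3]; field_simp
    rw [this, one_smul]

/-- Density is applied to `a` rather than to `center a`, since `normalize` is rational in `a`, while
recovering `a` from its center takes a square root. -/
lemma exists_ratPoint_center_mem {U : Set E3} (hU : IsOpen U) {q : E3} (hqU : q ∈ U)
    (hq : ‖q‖ < 1) : ∃ r, ‖ratPoint r‖ < 1 ∧ center (ratPoint r) ∈ U := by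
  obtain ⟨a, ha, rfl⟩ := exists_center_eq hq
  obtain ⟨r, hr⟩ := denseRange_ratPoint.exists_mem_open
    ((hU.preimage continuous_center).inter (Metric.isOpen_ball (x := (0 : E3)) (ε := 1)))
    ⟨a, hqU, by simpa using ha⟩
  exact ⟨r, by simpa using hr.2, hr.1⟩

lemma norm_center_lt_one {a : E3} (ha : ‖a‖ < 1) : ‖center a‖ < 1 := by
  rw [center, norm_smul, Real.norm_of_nonneg (by positivity), div_mul_eq_mul_div,
    div_lt_one (by positivity)]
  nlinarith [sq_pos_of_pos (sub_pos.2 ha)]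

/-- The linear part of `normalize`. -/
noncomputable def normalizeLinear (a : E3) : E3 →ₗ[ℝ] E3 :=
  ((1 - ‖a‖ ^ 2) / (1 + ‖a‖ ^ 2)) • (LinearMap.id -
    (2 / (1 + ‖a‖ ^ 2)) • (innerSL ℝ a).toLinearMap.smulRight a)

lemma normalizeLinear_apply (a α : E3) : normalizeLinear a α =
    ((1 - ‖a‖ ^ 2) / (1 + ‖a‖ ^ 2)) • (α - (2 / (1 + ‖a‖ ^ 2) * inner ℝ a α) • a) := by
  simp [normalizeLinear, smul_smul]

lemma normalizeLinear_injective {a : E3} (ha : ‖a‖ < 1) :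
    Function.Injective (normalizeLinear a) := by
  rw [injective_iff_map_eq_zero]
  intro α hα
  have hs : 0 < 1 - ‖a‖ ^ 2 := by nlinarith [norm_nonneg a]
  have ht : 0 < 1 + ‖a‖ ^ 2 := by positivity
  rw [normalizeLinear_apply, smul_eq_zero] at hα
  have h1 := hα.resolve_left (by positivity)
  have h2 := congrArg (inner ℝ a) h1
  rw [inner_sub_right, inner_smul_right, real_inner_self_eq_norm_sq, inner_zero_right] at h2
  have h3 : inner ℝ a α * (1 - ‖a‖ ^ 2) = 0 := by
    field_simp at h2
    linarith
  have h4 : inner ℝ a α = 0 := (mul_eq_zero.1 h3).resolve_right hs.ne'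
  simpa [h4] using h1

/-- The affine map carrying the polar of the unit ball with respect to the point `center a` to
the unit ball. -/
noncomputable def normalize {a : E3} (ha : ‖a‖ < 1) : E3 ≃ᵃ[ℝ] E3 :=
  (LinearEquiv.ofInjectiveEndo (normalizeLinear a) (normalizeLinear_injective ha)).toAffineEquiv.trans
    (AffineEquiv.constVAdd ℝ E3 (-center a))

lemma normalize_apply {a : E3} (ha : ‖a‖ < 1) (α : E3) :
    normalize ha α = normalizeLinear a α - center a := by
  simp [normalize, sub_eq_neg_add]

/-- With `p = center a`, the form on the right vanishes at `α = β` exactly when `‖α‖ = 1 + ⟪α, p⟫`,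
the boundary of the polar of the ball translated by `-p`. Conjugacy with respect to this ellipsoid
thus becomes conjugacy with respect to the sphere. -/
lemma inner_normalize {a : E3} (ha : ‖a‖ < 1) (α β : E3) :
    inner ℝ (normalize ha α) (normalize ha β) - 1 = ((1 - ‖a‖ ^ 2) / (1 + ‖a‖ ^ 2)) ^ 2 *
      (inner ℝ α β - (1 + inner ℝ α (center a)) * (1 + inner ℝ β (center a))) := by
  have ht : 0 < 1 + ‖a‖ ^ 2 := by positivity
  have haa : inner ℝ a a = ‖a‖ ^ 2 := real_inner_self_eq_norm_sq a
  simp only [normalize_apply, normalizeLinear_apply, center, inner_sub_left, inner_sub_right,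
    real_inner_smul_left, real_inner_smul_right, haa]
  rw [real_inner_comm α a, real_inner_comm β a]
  field_simp
  ring

/-! ### The field of coordinates -/

lemma inner_eq_sum (x y : E3) : inner ℝ x y = ∑ i, x i * y i := by
  simp [PiLp.inner_apply, mul_comm]

/-- The vertices of the polar of a polytope with vertices over `k` are defined over `k`. -/
lemma coord_mem_of_mem_extremePoints_polar {V : Set E3} (hV : V.Finite)
    (k : IntermediateField ℚ ℝ) (hk : ∀ v ∈ V, ∀ i, v i ∈ k) {α : E3}
    (hα : α ∈ (polar (convexHull ℝ V)).extremePoints ℝ) (i : Fin 3) : α i ∈ k := by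
  -- A `k`-linear retraction of `ℝ` onto `k`, applied to each coordinate of `α`, preserves the
  -- active equations, which have coefficients in `k`. Their solution is unique, so `α` is fixed.
  obtain ⟨π, hπ⟩ := LinearMap.exists_leftInverse_of_injective (Algebra.linearMap k ℝ)
    (LinearMap.ker_eq_bot.2 (algebraMap k ℝ).injective)
  have hπ1 : ∀ c : k, π (c : ℝ) = c := fun c => LinearMap.congr_fun hπ c
  have hβ : (WithLp.toLp 2 fun j => ((π (α j) : k) : ℝ) : E3) = α := by
    refine eq_of_mem_extremePoints_polar hV hα fun v hv h1 => ?_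
    rw [inner_eq_sum] at h1 ⊢
    have h2 : ((π (∑ j, α j * v j) : k) : ℝ) = 1 := by
      rw [h1]
      simpa using congrArg (Subtype.val) (hπ1 1)
    rw [← h2, map_sum, AddSubmonoidClass.coe_finsetSum]
    refine Finset.sum_congr rfl fun j _ => ?_
    have h3 : α j * v j = (⟨v j, hk v hv j⟩ : k) • α j := by
      rw [IntermediateField.smul_def, smul_eq_mul, mul_comm]
    rw [h3, map_smul, smul_eq_mul, MulMemClass.coe_mul, mul_comm]
  rw [← hβ]
  exact (π (α i)).2

lemma coordDegree_mono {K L : Set E3} (h : coordField K ≤ coordField L) :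
    coordDegree K ≤ coordDegree L := by
  refine OrderHomClass.mono Cardinal.toENat ?_
  exact Submodule.rank_mono (s := (coordField K).toSubalgebra.toSubmodule)
    (t := (coordField L).toSubalgebra.toSubmodule) h

lemma ratPoint_mem (k : IntermediateField ℚ ℝ) (r : Fin 3 → ℚ) (i : Fin 3) : ratPoint r i ∈ k :=
  k.algebraMap_mem (r i)

lemma inner_mem (k : IntermediateField ℚ ℝ) {x y : E3} (hx : ∀ i, x i ∈ k) (hy : ∀ i, y i ∈ k) :
    inner ℝ x y ∈ k := by
  rw [inner_eq_sum]
  exact sum_mem fun i _ => mul_mem (hx i) (hy i)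

lemma norm_sq_mem (k : IntermediateField ℚ ℝ) {x : E3} (hx : ∀ i, x i ∈ k) : ‖x‖ ^ 2 ∈ k := by
  rw [← real_inner_self_eq_norm_sq]
  exact inner_mem k hx hx

lemma center_mem (k : IntermediateField ℚ ℝ) {a : E3} (ha : ∀ i, a i ∈ k) (i : Fin 3) :
    center a i ∈ k := by
  rw [center, PiLp.smul_apply, smul_eq_mul]
  exact mul_mem (div_mem (ofNat_mem k 2) (add_mem (one_mem _) (norm_sq_mem k ha))) (ha i)

lemma normalize_mem (k : IntermediateField ℚ ℝ) {a : E3} (ha1 : ‖a‖ < 1) (ha : ∀ i, a i ∈ k)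
    {α : E3} (hα : ∀ i, α i ∈ k) (i : Fin 3) : normalize ha1 α i ∈ k := by
  rw [normalize_apply, normalizeLinear_apply, PiLp.sub_apply, PiLp.smul_apply, PiLp.sub_apply,
    PiLp.smul_apply, smul_eq_mul, smul_eq_mul]
  have hn := norm_sq_mem k ha
  have ht : 1 + ‖a‖ ^ 2 ∈ k := add_mem (one_mem _) hn
  exact sub_mem (mul_mem (div_mem (sub_mem (one_mem _) hn) ht) (sub_mem (hα i)
    (mul_mem (mul_mem (div_mem (ofNat_mem k 2) ht) (inner_mem k ha hα)) (ha i))))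
    (center_mem k ha i)

/-! ### Dual Koebe realizations -/

/-- A Koebe realization of `P` gives rise to a Koebe realization of a dual of `P` whose vertex
coordinates lie in the same field. -/
lemma exists_dual_koebeRealization {P Q K : Set E3} (hPQ : IsDual P Q)
    (hK : IsKoebeRealization P K) :
    ∃ K', IsKoebeRealization Q K' ∧ coordDegree K' ≤ coordDegree K := by
  obtain ⟨R, hR, hRP, hR0, hQR⟩ := hPQ
  obtain ⟨q, hqK, hq⟩ := exists_mem_interior_norm_lt_one hK.isPolytope hK.tangent
  obtain ⟨r, har, hp⟩ := exists_ratPoint_center_mem isOpen_interior hqK hq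
  set a := ratPoint r with ha
  set p := center a with hpdef
  have hp1 : ‖p‖ < 1 := norm_center_lt_one har
  set τ : E3 ≃ᵃ[ℝ] E3 := AffineEquiv.constVAdd ℝ E3 (-p) with hτ
  have hτa : ∀ y, τ y = y - p := fun y => by simp [hτ, sub_eq_neg_add]
  set K₀ := τ '' K with hK₀
  have hK₀P : IsPolytope3 K₀ := isPolytope3_image τ hK.isPolytope
  have h0 : (0 : E3) ∈ interior K₀ := by
    have h := (AffineEquiv.toContinuousAffineEquiv τ).toHomeomorph.image_interior K
    exact h.subset ⟨p, hp, by
      change τ p = 0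
      rw [hτa, sub_self]⟩
  set D := polar K₀ with hD
  have hDP : IsPolytope3 D := hK₀P.polar h0
  refine ⟨normalize har '' D, ⟨isPolytope3_image _ hDP, ?_, ?_⟩, ?_⟩
  · refine (combEquiv_image _ D).symm.trans (CombEquiv.trans ?_ hQR.symm)
    exact CombEquiv.polar hK₀P h0 hR hR0
      ((combEquiv_image τ K).symm.trans (hK.combEquiv.trans hRP.symm))
  · intro E' hE'
    have hE := isEdge_symm_image _ hE'
    set E := (normalize har).symm '' E' with hEdef
    have hEE' : E' = normalize har '' E := (image_symm_image _ E').symm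
    obtain ⟨he₀, heE⟩ := isEdge_dualFace hK₀P h0 hE
    set e₀ := dualFace (polar K₀) E with he₀def
    have he := isEdge_symm_image τ he₀
    obtain ⟨x, hxe, hx, hxy⟩ := hK.tangent _ he
    have hmem : ∀ y ∈ e₀, y + p ∈ τ.symm '' e₀ := fun y hy =>
      ⟨y, hy, τ.injective (by rw [AffineEquiv.apply_symm_apply, hτa, add_sub_cancel_right])⟩
    have hxe₀ : x - p ∈ e₀ := by
      obtain ⟨y, hy, hyx⟩ := hxe
      rw [← hyx, ← hτa, AffineEquiv.apply_symm_apply]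
      exact hy
    have hpx : 0 < 1 - inner ℝ x p := by
      have := real_inner_le_norm x p
      rw [hx, one_mul] at this
      linarith
    -- This is the supporting plane `⟪x, y⟫ = 1` rewritten with `p` as origin; its image will be the
    -- new contact point.
    set β := (1 - inner ℝ x p)⁻¹ • x with hβ
    have hβE : β ∈ E := by
      rw [← heE]
      refine ⟨?_, fun y hy => ?_⟩
      · rintro _ ⟨y, hy, rfl⟩
        have := inner_le_one_of_contact hK.isPolytope hK.tangent he hxe hx hxy hy
        rw [hτa, hβ, real_inner_smul_left, inner_sub_right, inv_mul_le_iff₀ hpx, mul_one]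
        linarith
      · have := hxy _ (hmem y hy)
        rw [inner_add_right] at this
        rw [hβ, real_inner_smul_left, inv_mul_eq_one₀ hpx.ne']
        linarith
    have hone : ∀ α ∈ E, inner ℝ (normalize har β) (normalize har α) = 1 := fun α hα => by
      have h1 : inner ℝ α x = 1 + inner ℝ α p := by
        rw [← heE] at hα
        have := hα.2 _ hxe₀
        rw [inner_sub_right] at this
        linarith
      have h2 := inner_normalize har β α
      rw [← hpdef, real_inner_comm α β, hβ, real_inner_smul_right, real_inner_smul_left, h1] at h2
      -- This says `β = (1 + ⟪β, p⟫) • x`, so by `h1` the form in `inner_normalize` vanishes on `β`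
      -- and `α`.
      have h3 : 1 + (1 - inner ℝ x p)⁻¹ * inner ℝ x p = (1 - inner ℝ x p)⁻¹ := by
        field_simp; ring
      rw [h3, sub_self, mul_zero] at h2
      exact sub_eq_zero.1 h2
    refine ⟨normalize har β, hEE' ▸ ⟨β, hβE, rfl⟩, ?_, ?_⟩
    · have := hone β hβE
      rw [real_inner_self_eq_norm_sq] at this
      exact (pow_eq_one_iff_of_nonneg (norm_nonneg _) two_ne_zero).1 this
    · rw [hEE']
      rintro _ ⟨α, hα, rfl⟩
      exact hone α hα
  · apply coordDegree_mono
    rw [coordField, IntermediateField.adjoin_le_iff]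
    rintro c ⟨w, hw, i, rfl⟩
    obtain ⟨α, hα, rfl⟩ := extremePoints_image _ _ hw
    set k := coordField K
    refine normalize_mem k har (ratPoint_mem k r) (fun j => ?_) i
    rw [hD, ← hK₀P.convexHull_extremePoints] at hα
    refine coord_mem_of_mem_extremePoints_polar hK₀P.finite_extremePoints k (fun v hv l => ?_) hα j
    obtain ⟨u, hu, rfl⟩ := extremePoints_image τ K hv
    rw [hτa, PiLp.sub_apply]
    exact sub_mem (IntermediateField.subset_adjoin ℚ _ ⟨u, hu, l, rfl⟩)
      (center_mem k (ratPoint_mem k r) l)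

lemma koebeDegree_le_of_isDual {P Q : Set E3} (hPQ : IsDual P Q) :
    koebeDegree Q ≤ koebeDegree P := by
  refine le_sInf ?_
  rintro _ ⟨K, hK, rfl⟩
  obtain ⟨K', hK', hle⟩ := exists_dual_koebeRealization hPQ hK
  exact le_trans (sInf_le (by exact ⟨K', hK', rfl⟩)) hle

end Koebe

theorem proposition3p6 (P Q : Set Koebe.E3) (hP : Koebe.IsPolytope3 P) (hQ : Koebe.IsPolytope3 Q)
    (hPQ : Koebe.IsDual P Q) : Koebe.koebeDegree P = Koebe.koebeDegree Q :=
  le_antisymm (Koebe.koebeDegree_le_of_isDual hPQ.symm) (Koebe.koebeDegree_le_of_isDual hPQ)
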